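/- Let $V\in C^2(\mathbb{R}^n)$ be such that $\mu(\mathrm{d}x)=e^{-V(x)}\,\mathrm{d}x$ is a probability measure on $\mathbb{R}^n$, and suppose that $\mathrm{Hess}(V)\geqslant c\,\mathrm{Id}$ on $\mathbb{R}^n$ for some constant $c>0$. Let $\mathcal{E}(f,g)=\int \nabla f\cdot\nabla g\,\mathrm{d}\mu$ be the associated Dirichlet form, whose domain $\mathcal{D}(\mathcal{E})\subset L^2(\mu)$ is the closure of $C_c^\infty(\mathbb{R}^n)$ with respect to the norm $\left(\int f^2\,\mathrm{d}\mu+\mathcal{E}(f,f)\right)^{1/2}$. Then $\mu$ satisfies the log-Sobolev inequality with constant $2/c$: for every $f\in\mathcal{D}(\mathcal{E})$, the function $f^2\log f^2$ is $\mu$-integrable and \[ \mathrm{Ent}(f^2):=\int f^2\log f^2\,\mathrm{d}\mu-\left(\int f^2\,\mathrm{d}\mu\right)\log\left(\int f^2\,\mathrm{d}\mu\right)\leqslant \frac{2}{c}\,\mathcal{E}(f,f), \] with the convention $0\log 0=0$. -/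

import Mathlib

open MeasureTheory Filter Topology
open scoped ContDiff

noncomputable section

/-- The measure `e^{-V} dx` on `ℝⁿ`. -/
def gibbsMeasure {n : ℕ} (V : EuclideanSpace ℝ (Fin n) → ℝ) :
    Measure (EuclideanSpace ℝ (Fin n)) :=
  (volume : Measure (EuclideanSpace ℝ (Fin n))).withDensity
    fun x => ENNReal.ofReal (Real.exp (-V x))

/-- `f ∈ L²(μ)` and `G ∈ L²(μ; ℝⁿ)` are the limits in `L²(μ)` of `φ k` and `∇ (φ k)` for some
sequence of smooth compactly supported functions `φ k`. In other words, `(f, G)` lies in the closure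
of the graph of the gradient on `C_c^∞(ℝⁿ)`, i.e. `f` lies in the closure of `C_c^∞(ℝⁿ)` for the
norm `(‖f‖² + 𝓔(f, f))^{1/2}`. -/
def IsDirichletGradient {n : ℕ} (μ : Measure (EuclideanSpace ℝ (Fin n)))
    (f : EuclideanSpace ℝ (Fin n) → ℝ)
    (G : EuclideanSpace ℝ (Fin n) → EuclideanSpace ℝ (Fin n)) : Prop :=
  MemLp f 2 μ ∧ MemLp G 2 μ ∧
    ∃ φ : ℕ → EuclideanSpace ℝ (Fin n) → ℝ,
      (∀ k, ContDiff ℝ ∞ (φ k)) ∧ (∀ k, HasCompactSupport (φ k)) ∧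
      Tendsto (fun k => eLpNorm (fun x => φ k x - f x) 2 μ) atTop (𝓝 0) ∧
      Tendsto (fun k => eLpNorm (fun x => gradient (φ k) x - G x) 2 μ) atTop (𝓝 0)

/-- The domain `𝓓(𝓔)` in `L²(μ)` of the Dirichlet form. -/
def dirichletDomain {n : ℕ} (μ : Measure (EuclideanSpace ℝ (Fin n))) :
    Set (EuclideanSpace ℝ (Fin n) → ℝ) :=
  {f | ∃ G, IsDirichletGradient μ f G}

open Classical in
/-- The gradient of `f ∈ 𝓓(𝓔)`, which is `μ`-a.e. unique for `μ = e^{-V} dx`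
(see `IsDirichletGradient.ae_unique`). -/
def dirichletGradient {n : ℕ} (μ : Measure (EuclideanSpace ℝ (Fin n)))
    (f : EuclideanSpace ℝ (Fin n) → ℝ) : EuclideanSpace ℝ (Fin n) → EuclideanSpace ℝ (Fin n) :=
  if h : ∃ G, IsDirichletGradient μ f G then h.choose else 0

/-- The Dirichlet form `𝓔(f, g) = ∫ Γ(f, g) dμ` with `Γ(f, g) = ∇f · ∇g`, for `f, g ∈ 𝓓(𝓔)`. -/
def dirichletForm {n : ℕ} (μ : Measure (EuclideanSpace ℝ (Fin n)))
    (f g : EuclideanSpace ℝ (Fin n) → ℝ) : ℝ :=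
  ∫ x, inner ℝ (dirichletGradient μ f x) (dirichletGradient μ g x) ∂μ

/-- The entropy `Ent(h) = μ(h log h) - μ(h) log μ(h)` of a nonnegative function. -/
def entropy {n : ℕ} (μ : Measure (EuclideanSpace ℝ (Fin n)))
    (h : EuclideanSpace ℝ (Fin n) → ℝ) : ℝ :=
  ∫ x, h x * Real.log (h x) ∂μ - (∫ x, h x ∂μ) * Real.log (∫ x, h x ∂μ)

/-- The log-Sobolev inequality with constant `C`; it includes that `Ent(f²)` is finite. -/
def LogSobolev {n : ℕ} (μ : Measure (EuclideanSpace ℝ (Fin n))) (C : ℝ) : Prop :=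
  ∀ f ∈ dirichletDomain μ,
    Integrable (fun x => f x ^ 2 * Real.log (f x ^ 2)) μ ∧
      entropy μ (fun x => f x ^ 2) ≤ C * dirichletForm μ f f

/-- Pairing with a fixed element of `L²` is continuous. -/
theorem tendsto_integral_mul_of_eLpNorm {α : Type*} [MeasurableSpace α] {μ : Measure α}
    {u : ℕ → α → ℝ} {w : α → ℝ} (hu : ∀ k, MemLp (u k) 2 μ) (hw : MemLp w 2 μ)
    (h : Tendsto (fun k => eLpNorm (u k) 2 μ) atTop (𝓝 0)) :
    Tendsto (fun k => ∫ x, w x * u k x ∂μ) atTop (𝓝 0) := by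
  have hb : ∀ k, eLpNorm (fun x => w x * u k x) 1 μ ≤ eLpNorm w 2 μ * eLpNorm (u k) 2 μ := by
    intro k
    have := eLpNorm_smul_le_mul_eLpNorm (p := 2) (q := 2) (r := 1) (hu k).1 hw.1
    exact this
  have h0 : Tendsto (fun k => eLpNorm w 2 μ * eLpNorm (u k) 2 μ) atTop (𝓝 0) := by
    have := ENNReal.Tendsto.const_mul (a := eLpNorm w 2 μ) h (Or.inr hw.2.ne)
    simpa using this
  have h1 : Tendsto (fun k => eLpNorm (fun x => w x * u k x) 1 μ) atTop (𝓝 0) :=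
    tendsto_of_tendsto_of_tendsto_of_le_of_le tendsto_const_nhds h0 (fun _ => zero_le) hb
  have h2 := tendsto_integral_of_L1' (μ := μ) (fun _ => (0 : ℝ)) aestronglyMeasurable_const
    (F := fun k x => w x * u k x) (l := atTop)
    (Eventually.of_forall fun k => hw.integrable_mul (hu k)) (by
      refine h1.congr fun k => ?_
      congr 1
      ext x
      simp)
  simpa using h2

/-- Convergence in `L²` passes to differences. -/
theorem tendsto_eLpNorm_sub_sub {α F : Type*} [MeasurableSpace α] [NormedAddCommGroup F]
    {μ : Measure α} {u u' : ℕ → α → F} {w w' : α → F}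
    (hu : ∀ k, MemLp (u k) 2 μ) (hu' : ∀ k, MemLp (u' k) 2 μ) (hw : MemLp w 2 μ)
    (hw' : MemLp w' 2 μ)
    (h : Tendsto (fun k => eLpNorm (fun x => u k x - w x) 2 μ) atTop (𝓝 0))
    (h' : Tendsto (fun k => eLpNorm (fun x => u' k x - w' x) 2 μ) atTop (𝓝 0)) :
    Tendsto (fun k => eLpNorm (fun x => (u k x - u' k x) - (w x - w' x)) 2 μ) atTop (𝓝 0) := by
  have h0 : Tendsto (fun k => eLpNorm (fun x => u k x - w x) 2 μ +
      eLpNorm (fun x => u' k x - w' x) 2 μ) atTop (𝓝 0) := by simpa using h.add h'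
  refine tendsto_of_tendsto_of_tendsto_of_le_of_le tendsto_const_nhds h0 (fun _ => zero_le) ?_
  intro k
  have := eLpNorm_sub_le (p := 2) (μ := μ) (f := fun x => u k x - w x)
    (g := fun x => u' k x - w' x) ((hu k).sub hw).1 ((hu' k).sub hw').1 one_le_two
  refine le_trans (le_of_eq (eLpNorm_congr_ae (Eventually.of_forall fun x => ?_))) this
  exact sub_sub_sub_comm _ _ _ _

/-- Integration against `e^{-V} dx` as a weighted Lebesgue integral. -/
theorem integral_gibbsMeasure {n : ℕ} {V : EuclideanSpace ℝ (Fin n) → ℝ} (hV : Continuous V)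
    (u : EuclideanSpace ℝ (Fin n) → ℝ) :
    ∫ x, u x ∂(gibbsMeasure V) = ∫ x, Real.exp (-V x) * u x := by
  rw [gibbsMeasure, integral_withDensity_eq_integral_toReal_smul (by fun_prop) (by simp)]
  simp [ENNReal.toReal_ofReal (Real.exp_pos _).le]

/-- Integration by parts against `e^{-V} dx`. -/
theorem integral_gibbsMeasure_by_parts {n : ℕ} {V : EuclideanSpace ℝ (Fin n) → ℝ}
    (hV : ContDiff ℝ 1 V) {a ψ : EuclideanSpace ℝ (Fin n) → ℝ} (ha : ContDiff ℝ 1 a)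
    (hψ : ContDiff ℝ 1 ψ) (hψc : HasCompactSupport ψ) (v : EuclideanSpace ℝ (Fin n)) :
    ∫ x, ψ x * fderiv ℝ a x v ∂(gibbsMeasure V) =
      - ∫ x, (fderiv ℝ ψ x v - ψ x * fderiv ℝ V x v) * a x ∂(gibbsMeasure V) := by
  rw [integral_gibbsMeasure hV.continuous, integral_gibbsMeasure hV.continuous]
  have hE : ContDiff ℝ 1 (fun x => Real.exp (-V x) * ψ x) := by fun_prop
  have hEc : HasCompactSupport (fun x => Real.exp (-V x) * ψ x) := hψc.mul_left
  have hd : ∀ x, fderiv ℝ (fun x => Real.exp (-V x) * ψ x) x v =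
      Real.exp (-V x) * (fderiv ℝ ψ x v - ψ x * fderiv ℝ V x v) := by
    intro x
    have h1 : HasFDerivAt V (fderiv ℝ V x) x :=
      (hV.differentiable one_ne_zero x).hasFDerivAt
    have h2 : HasFDerivAt ψ (fderiv ℝ ψ x) x :=
      (hψ.differentiable one_ne_zero x).hasFDerivAt
    have h3 : HasFDerivAt (fun x => Real.exp (-V x) * ψ x) _ x := h1.neg.exp.mul h2
    rw [h3.fderiv]
    simp
    ring
  have hda : Continuous fun x => fderiv ℝ a x v :=
    (ha.continuous_fderiv one_ne_zero).clm_apply continuous_const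
  have hdE : Continuous fun x => fderiv ℝ (fun x => Real.exp (-V x) * ψ x) x v :=
    (hE.continuous_fderiv one_ne_zero).clm_apply continuous_const
  have hdEc : HasCompactSupport fun x => fderiv ℝ (fun x => Real.exp (-V x) * ψ x) x v :=
    (hEc.fderiv ℝ).comp_left
      (g := fun L : EuclideanSpace ℝ (Fin n) →L[ℝ] ℝ => L v) (by simp)
  have key := integral_mul_fderiv_eq_neg_fderiv_mul_of_integrable
    (μ := (volume : Measure (EuclideanSpace ℝ (Fin n))))
    (f := fun x => Real.exp (-V x) * ψ x) (g := a) (v := v)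
    ((hdE.mul ha.continuous).integrable_of_hasCompactSupport hdEc.mul_right)
    ((hE.continuous.mul hda).integrable_of_hasCompactSupport hEc.mul_right)
    ((hE.continuous.mul ha.continuous).integrable_of_hasCompactSupport hEc.mul_right)
    (fun x _ => hE.differentiable one_ne_zero x) (fun x _ => ha.differentiable one_ne_zero x)
  simp only [hd] at key
  simpa only [mul_assoc] using key

/-- The gradient on `C_c^∞(ℝⁿ)` is closable in `L²(e^{-V} dx)`, so that gradients are unique. -/
theorem IsDirichletGradient.ae_unique {n : ℕ} {V : EuclideanSpace ℝ (Fin n) → ℝ}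
    (hV : ContDiff ℝ 1 V) [IsFiniteMeasure (gibbsMeasure V)]
    {f : EuclideanSpace ℝ (Fin n) → ℝ}
    {G G' : EuclideanSpace ℝ (Fin n) → EuclideanSpace ℝ (Fin n)}
    (h : IsDirichletGradient (gibbsMeasure V) f G)
    (h' : IsDirichletGradient (gibbsMeasure V) f G') : G =ᵐ[gibbsMeasure V] G' := by
  obtain ⟨hf, hG, φ, hφ, hφc, hφf, hφG⟩ := h
  obtain ⟨-, hG', φ', hφ', hφc', hφf', hφG'⟩ := h'
  have hcont : ∀ {u : EuclideanSpace ℝ (Fin n) → ℝ}, ContDiff ℝ ∞ u → Continuous (gradient u) :=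
    fun hu => (LinearIsometryEquiv.continuous _).comp (hu.continuous_fderiv (by simp))
  have hcs : ∀ {u : EuclideanSpace ℝ (Fin n) → ℝ}, HasCompactSupport u →
      HasCompactSupport (gradient u) :=
    fun hu => (hu.fderiv ℝ).comp_left
      (g := (InnerProductSpace.toDual ℝ (EuclideanSpace ℝ (Fin n))).symm) (by simp)
  have hm : ∀ {u : EuclideanSpace ℝ (Fin n) → ℝ}, ContDiff ℝ ∞ u → HasCompactSupport u →
      MemLp u 2 (gibbsMeasure V) := fun hu hc => hu.continuous.memLp_of_hasCompactSupport hc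
  have hmg : ∀ {u : EuclideanSpace ℝ (Fin n) → ℝ}, ContDiff ℝ ∞ u → HasCompactSupport u →
      MemLp (gradient u) 2 (gibbsMeasure V) :=
    fun hu hc => (hcont hu).memLp_of_hasCompactSupport (hcs hc)
  have ha := tendsto_eLpNorm_sub_sub (fun k => hm (hφ k) (hφc k)) (fun k => hm (hφ' k) (hφc' k))
    hf hf hφf hφf'
  have hg := tendsto_eLpNorm_sub_sub (fun k => hmg (hφ k) (hφc k))
    (fun k => hmg (hφ' k) (hφc' k)) hG hG' hφG hφG'
  simp only [sub_self, sub_zero] at ha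
  have hGi : Integrable (fun x => G x - G' x) (gibbsMeasure V) :=
    (hG.sub hG').integrable one_le_two
  suffices hz : ∀ᵐ x ∂(gibbsMeasure V), G x - G' x = 0 by
    filter_upwards [hz] with x hx using sub_eq_zero.1 hx
  refine ae_eq_zero_of_integral_contDiff_smul_eq_zero hGi.locallyIntegrable ?_
  intro ψ hψ hψc
  have hψ1 : ContDiff ℝ 1 ψ := hψ.of_le (by exact_mod_cast le_top)
  have hψm : MemLp ψ 2 (gibbsMeasure V) := hm hψ hψc
  refine ext_inner_right ℝ fun v => ?_
  have hψG : Integrable (fun x => ψ x • (G x - G' x)) (gibbsMeasure V) :=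
    hGi.locallyIntegrable.integrable_smul_left_of_hasCompactSupport hψ.continuous hψc
  rw [inner_zero_left, real_inner_comm, ← integral_inner hψG]
  have hr : ∀ k, MemLp (fun x => inner ℝ (gradient (φ k) x - gradient (φ' k) x -
      (G x - G' x)) v) 2 (gibbsMeasure V) := fun k =>
    (((hmg (hφ k) (hφc k)).sub (hmg (hφ' k) (hφc' k))).sub (hG.sub hG')).inner_const v
  have hA := tendsto_integral_mul_of_eLpNorm hr hψm (by
    have h0 : Tendsto (fun k => ENNReal.ofReal ‖v‖ * eLpNorm (fun x => gradient (φ k) x -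
        gradient (φ' k) x - (G x - G' x)) 2 (gibbsMeasure V)) atTop (𝓝 0) := by
      simpa using ENNReal.Tendsto.const_mul (a := ENNReal.ofReal ‖v‖) hg (Or.inr ENNReal.ofReal_ne_top)
    refine tendsto_of_tendsto_of_tendsto_of_le_of_le tendsto_const_nhds h0
      (fun _ => zero_le) fun k => ?_
    refine eLpNorm_le_mul_eLpNorm_of_ae_le_mul (Eventually.of_forall fun x => ?_) 2
    rw [mul_comm]
    exact norm_inner_le_norm _ _)
  have hψd : Continuous fun x => fderiv ℝ ψ x v :=
    (hψ1.continuous_fderiv one_ne_zero).clm_apply continuous_const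
  have hVd : Continuous fun x => fderiv ℝ V x v :=
    (hV.continuous_fderiv one_ne_zero).clm_apply continuous_const
  have hwm : MemLp (fun x => fderiv ℝ ψ x v - ψ x * fderiv ℝ V x v) 2 (gibbsMeasure V) := by
    refine MemLp.sub ?_ ?_
    · exact hψd.memLp_of_hasCompactSupport ((hψc.fderiv ℝ).comp_left
        (g := fun L : EuclideanSpace ℝ (Fin n) →L[ℝ] ℝ => L v) (by simp))
    · exact (hψ.continuous.mul hVd).memLp_of_hasCompactSupport hψc.mul_right
  have hB := tendsto_integral_mul_of_eLpNorm
    (fun k => (hm (hφ k) (hφc k)).sub (hm (hφ' k) (hφc' k))) hwm ha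
  have hGv : Integrable (fun x => ψ x * inner ℝ (G x - G' x) v) (gibbsMeasure V) :=
    hψm.integrable_mul ((hG.sub hG').inner_const v)
  have hgk : ∀ k x, inner ℝ (gradient (φ k) x - gradient (φ' k) x) v =
      fderiv ℝ (φ k - φ' k) x v := by
    intro k x
    rw [fderiv_sub ((hφ k).differentiable (by simp) x) ((hφ' k).differentiable (by simp) x),
      inner_sub_left]
    simp [gradient]
  have hC : ∀ k, ∫ x, ψ x * inner ℝ (gradient (φ k) x - gradient (φ' k) x - (G x - G' x)) v
      ∂(gibbsMeasure V) =
      -(∫ x, (fderiv ℝ ψ x v - ψ x * fderiv ℝ V x v) * (φ k - φ' k) x ∂(gibbsMeasure V)) -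
        ∫ x, ψ x * inner ℝ (G x - G' x) v ∂(gibbsMeasure V) := by
    intro k
    have hk1 : ContDiff ℝ 1 (φ k - φ' k) :=
      ((hφ k).sub (hφ' k)).of_le (by exact_mod_cast le_top)
    have hki : Integrable (fun x => ψ x * inner ℝ (gradient (φ k) x - gradient (φ' k) x) v)
        (gibbsMeasure V) :=
      hψm.integrable_mul (((hmg (hφ k) (hφc k)).sub (hmg (hφ' k) (hφc' k))).inner_const v)
    rw [← integral_gibbsMeasure_by_parts hV hk1 hψ1 hψc v]
    simp only [← hgk]
    rw [← integral_sub hki hGv]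
    congr 1
    ext x
    rw [inner_sub_left (gradient (φ k) x - gradient (φ' k) x)]
    ring
  have hD := (hB.neg).sub_const (∫ x, ψ x * inner ℝ (G x - G' x) v ∂(gibbsMeasure V))
  have hE := tendsto_nhds_unique hA (hD.congr fun k => (hC k).symm)
  have hF : ∫ x, inner ℝ v (ψ x • (G x - G' x)) ∂(gibbsMeasure V) =
      ∫ x, ψ x * inner ℝ (G x - G' x) v ∂(gibbsMeasure V) := by
    congr 1
    ext x
    rw [inner_smul_right, real_inner_comm]
  rw [hF]
  linarith

end

/-!
The argument is that of Bobkov and Ledoux. Applied to `e^{g / (1 - s) - V}` and `e^{-V}` with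
weights `1 - s` and `s`, the Prékopa–Leindler inequality gives
`(∫ e^{g / (1 - s)} dμ)^{1 - s} ≤ ∫ e^{g + θ(s) |∇g|²} dμ`, where strong convexity of `V` allows
`θ(s) = s / (2c) + o(s)`. Both sides equal `∫ e^g dμ` at `s = 0`, and comparing their logarithmic
derivatives there yields `Ent(e^g) ≤ (2c)⁻¹ ∫ |∇g|² e^g dμ`. For `g = log (φ² + ε)` with `φ` smooth
and compactly supported, `|∇g|² e^g ≤ 4 |∇φ|²`; the general case follows by Fatou's lemma.

The Prékopa–Leindler inequality itself passes to products and to linear images, which reduces it to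
the real line. There, once `f` and `g` have the same supremum, the superlevel sets of `h` contain
the Minkowski combinations of those of `f` and `g`, and `|A + B| ≥ |A| + |B|`.
-/

/-! ### The Prékopa–Leindler inequality -/

open scoped ENNReal Pointwise

theorem volume_add_volume_le_of_isCompact {A B : Set ℝ} (hA : IsCompact A) (hB : IsCompact B)
    (hA₀ : A.Nonempty) (hB₀ : B.Nonempty) : volume A + volume B ≤ volume (A + B) := by
  obtain ⟨a, haA, ha⟩ := hA.exists_isGreatest hA₀
  obtain ⟨b, hbB, hb⟩ := hB.exists_isLeast hB₀
  -- `A + b` lies to the left of `a + b` and `a + B` to the right of it.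
  have hdisj : AEDisjoint volume (b +ᵥ A) (a +ᵥ B) := by
    refine measure_mono_null (t := {a + b}) ?_ (by simp)
    rintro z ⟨⟨x, hx, hxz⟩, ⟨y, hy, hyz⟩⟩
    simp only [vadd_eq_add] at hxz hyz
    have hxa := ha hx
    have hby := hb hy
    rw [Set.mem_singleton_iff]
    linarith
  calc volume A + volume B = volume (b +ᵥ A) + volume (a +ᵥ B) := by
        rw [measure_vadd, measure_vadd]
    _ = volume ((b +ᵥ A) ∪ (a +ᵥ B)) :=
        (measure_union₀ (hB.vadd a).measurableSet.nullMeasurableSet hdisj).symm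
    _ ≤ volume (A + B) := by
        refine measure_mono (Set.union_subset ?_ ?_)
        · rw [add_comm]
          exact Set.vadd_set_subset_vadd hbB
        · exact Set.vadd_set_subset_vadd haA

theorem volume_add_volume_le {A B : Set ℝ} (hA : MeasurableSet A) (hB : MeasurableSet B)
    (hA₀ : A.Nonempty) (hB₀ : B.Nonempty) : volume A + volume B ≤ volume (A + B) := by
  obtain ⟨a, ha⟩ := hA₀
  obtain ⟨b, hb⟩ := hB₀
  rw [hA.measure_eq_iSup_isCompact, hB.measure_eq_iSup_isCompact]
  simp only [iSup_and']
  refine ENNReal.biSup_add_biSup_le' ⟨∅, Set.empty_subset A, isCompact_empty⟩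
    ⟨∅, Set.empty_subset B, isCompact_empty⟩ fun K ⟨hKA, hK⟩ L ⟨hLB, hL⟩ => ?_
  calc volume K + volume L ≤ volume (insert a K) + volume (insert b L) :=
        add_le_add (measure_mono (Set.subset_insert a K)) (measure_mono (Set.subset_insert b L))
    _ ≤ volume (insert a K + insert b L) :=
        volume_add_volume_le_of_isCompact (hK.insert a) (hL.insert b)
          (Set.insert_nonempty a K) (Set.insert_nonempty b L)
    _ ≤ volume (A + B) :=
        measure_mono (Set.add_subset_add (Set.insert_subset ha hKA) (Set.insert_subset hb hLB))

theorem lintegral_eq_lintegral_measure_ofReal_lt {α : Type*} [MeasurableSpace α] (μ : Measure α)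
    [SFinite μ] {f : α → ℝ≥0∞} (hf : Measurable f) :
    ∫⁻ x, f x ∂μ = ∫⁻ l in Set.Ioi (0 : ℝ), μ {x | ENNReal.ofReal l < f x} := by
  have hvol : ∀ y : ℝ≥0∞, volume.restrict (Set.Ioi 0) {l : ℝ | ENNReal.ofReal l < y} = y := by
    intro y
    rw [Measure.restrict_apply (measurableSet_lt (by fun_prop) measurable_const)]
    rcases eq_or_ne y ⊤ with rfl | hy
    · simp
    · have hset : {l : ℝ | ENNReal.ofReal l < y} ∩ Set.Ioi 0 = Set.Ioo 0 y.toReal := by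
        ext l
        exact and_comm.trans (and_congr_right fun hl =>
          ENNReal.ofReal_lt_iff_lt_toReal (Set.mem_Ioi.1 hl).le hy)
      rw [hset, Real.volume_Ioo, sub_zero, ENNReal.ofReal_toReal hy]
  have hgraph : MeasurableSet {p : α × ℝ | ENNReal.ofReal p.2 < f p.1} :=
    measurableSet_lt (by fun_prop) (by fun_prop)
  calc ∫⁻ x, f x ∂μ = (μ.prod (volume.restrict (Set.Ioi 0)))
          {p : α × ℝ | ENNReal.ofReal p.2 < f p.1} := by
        rw [Measure.prod_apply hgraph]
        exact (lintegral_congr fun x => hvol (f x)).symm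
    _ = ∫⁻ l in Set.Ioi (0 : ℝ), μ {x | ENNReal.ofReal l < f x} :=
        Measure.prod_apply_symm hgraph

theorem ofReal_mul_lintegral_add_le_of_min_le {f g h : ℝ → ℝ≥0∞} (hf : Measurable f)
    (hg : Measurable g) (hh : Measurable h) (hsup : ⨆ x, f x = ⨆ x, g x) {t s : ℝ} (ht : 0 < t)
    (hs : 0 < s) (H : ∀ x y, min (f x) (g y) ≤ h (t * x + s * y)) :
    ENNReal.ofReal t * (∫⁻ x, f x) + ENNReal.ofReal s * (∫⁻ x, g x) ≤ ∫⁻ x, h x := by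
  have hanti : ∀ u : ℝ → ℝ≥0∞, Measurable fun l : ℝ => volume {x | ENNReal.ofReal l < u x} :=
    fun u => Antitone.measurable fun l m hlm =>
      measure_mono fun x hx => (ENNReal.ofReal_le_ofReal hlm).trans_lt hx
  rw [lintegral_eq_lintegral_measure_ofReal_lt _ hf, lintegral_eq_lintegral_measure_ofReal_lt _ hg,
    lintegral_eq_lintegral_measure_ofReal_lt _ hh, ← lintegral_const_mul _ (hanti f),
    ← lintegral_const_mul _ (hanti g), ← lintegral_add_left ((hanti f).const_mul _)]
  refine lintegral_mono fun l => ?_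
  rcases lt_or_ge (ENNReal.ofReal l) (⨆ x, f x) with hl | hl
  · have hfl : {x | ENNReal.ofReal l < f x}.Nonempty := lt_iSup_iff.1 hl
    have hgl : {x | ENNReal.ofReal l < g x}.Nonempty := lt_iSup_iff.1 (hl.trans_eq hsup)
    calc ENNReal.ofReal t * volume {x | ENNReal.ofReal l < f x} +
          ENNReal.ofReal s * volume {x | ENNReal.ofReal l < g x}
        = volume (t • {x | ENNReal.ofReal l < f x}) +
            volume (s • {x | ENNReal.ofReal l < g x}) := by
          simp [Measure.addHaar_smul, abs_of_pos ht, abs_of_pos hs]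
      _ ≤ volume (t • {x | ENNReal.ofReal l < f x} + s • {x | ENNReal.ofReal l < g x}) :=
          volume_add_volume_le
            ((measurableSet_lt measurable_const hf).const_smul_of_ne_zero ht.ne')
            ((measurableSet_lt measurable_const hg).const_smul_of_ne_zero hs.ne')
            (hfl.smul_set) (hgl.smul_set)
      _ ≤ volume {x | ENNReal.ofReal l < h x} := by
          refine measure_mono ?_
          rintro _ ⟨_, ⟨x, hx, rfl⟩, _, ⟨y, hy, rfl⟩, rfl⟩
          exact (lt_min hx hy).trans_le (H x y)
  · have hempty : ∀ {u : ℝ → ℝ≥0∞}, ⨆ x, u x ≤ ENNReal.ofReal l →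
        {x | ENNReal.ofReal l < u x} = ∅ := fun hu =>
      Set.eq_empty_of_forall_notMem fun x hx => (hx.trans_le (le_iSup _ x)).not_ge hu
    simp [hempty hl, hempty (hsup.ge.trans hl)]

theorem rpow_mul_rpow_le_ofReal_mul_add {t s : ℝ} (ht : 0 < t) (hs : 0 < s) (hts : t + s = 1)
    (a b : ℝ≥0∞) : a ^ t * b ^ s ≤ ENNReal.ofReal t * a + ENNReal.ofReal s * b := by
  have hconj : (1 / t).HolderConjugate (1 / s) :=
    ⟨by simpa using hts, by positivity, by positivity⟩
  have hyoung := ENNReal.young_inequality (a ^ t) (b ^ s) hconj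
  rw [← ENNReal.rpow_mul, ← ENNReal.rpow_mul, mul_one_div_cancel ht.ne', mul_one_div_cancel hs.ne',
    ENNReal.rpow_one, ENNReal.rpow_one, one_div, one_div, ENNReal.ofReal_inv_of_pos ht,
    ENNReal.ofReal_inv_of_pos hs, div_eq_mul_inv, div_eq_mul_inv, inv_inv, inv_inv] at hyoung
  rwa [mul_comm _ a, mul_comm _ b]

/-- The Prékopa–Leindler inequality for `μ`, a functional form of log-concavity. Stating it for all
measurable `ℝ≥0∞`-valued functions makes it stable under products of measures. -/
def IsPrekopaLeindler {E : Type*} [AddCommMonoid E] [Module ℝ E] [MeasurableSpace E]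
    (μ : Measure E) : Prop :=
  ∀ ⦃t s : ℝ⦄, 0 < t → 0 < s → t + s = 1 → ∀ ⦃f g h : E → ℝ≥0∞⦄,
    Measurable f → Measurable g → Measurable h →
    (∀ x y, f x ^ t * g y ^ s ≤ h (t • x + s • y)) →
    (∫⁻ x, f x ∂μ) ^ t * (∫⁻ x, g x ∂μ) ^ s ≤ ∫⁻ x, h x ∂μ

theorem rpow_lintegral_mul_rpow_lintegral_le_of_iSup_eq {f g h : ℝ → ℝ≥0∞} (hf : Measurable f)
    (hg : Measurable g) (hh : Measurable h) (hsup : ⨆ x, f x = ⨆ x, g x) {t s : ℝ} (ht : 0 < t)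
    (hs : 0 < s) (hts : t + s = 1) (H : ∀ x y, f x ^ t * g y ^ s ≤ h (t * x + s * y)) :
    (∫⁻ x, f x) ^ t * (∫⁻ x, g x) ^ s ≤ ∫⁻ x, h x := by
  have hmin : ∀ x y, min (f x) (g y) ≤ h (t * x + s * y) := fun x y =>
    calc min (f x) (g y) = min (f x) (g y) ^ t * min (f x) (g y) ^ s := by
          rw [← ENNReal.rpow_add_of_nonneg _ _ ht.le hs.le, hts, ENNReal.rpow_one]
      _ ≤ f x ^ t * g y ^ s := by
          gcongr
          · exact min_le_left _ _
          · exact min_le_right _ _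
      _ ≤ h (t * x + s * y) := H x y
  exact (rpow_mul_rpow_le_ofReal_mul_add ht hs hts _ _).trans
    (ofReal_mul_lintegral_add_le_of_min_le hf hg hh hsup ht hs hmin)

theorem rpow_lintegral_mul_rpow_lintegral_le_of_iSup_ne_top {f g h : ℝ → ℝ≥0∞} (hf : Measurable f)
    (hg : Measurable g) (hh : Measurable h) (hf_top : ⨆ x, f x ≠ ⊤) (hg_top : ⨆ x, g x ≠ ⊤)
    {t s : ℝ} (ht : 0 < t) (hs : 0 < s) (hts : t + s = 1)
    (H : ∀ x y, f x ^ t * g y ^ s ≤ h (t * x + s * y)) :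
    (∫⁻ x, f x) ^ t * (∫⁻ x, g x) ^ s ≤ ∫⁻ x, h x := by
  set a := ⨆ x, f x
  set b := ⨆ x, g x
  have hzero : ∀ {u : ℝ → ℝ≥0∞}, ⨆ x, u x = 0 → ∫⁻ x, u x = 0 := fun hu => by
    simp [ENNReal.iSup_eq_zero.1 hu]
  rcases eq_or_ne a 0 with ha₀ | ha₀
  · simp [hzero ha₀, ENNReal.zero_rpow_of_pos ht]
  rcases eq_or_ne b 0 with hb₀ | hb₀
  · simp [hzero hb₀, ENNReal.zero_rpow_of_pos hs]
  have hat : a ^ t ≠ ⊤ := ENNReal.rpow_ne_top_of_nonneg ht.le hf_top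
  have hbs : b ^ s ≠ ⊤ := ENNReal.rpow_ne_top_of_nonneg hs.le hg_top
  have hdiv : ∀ u v : ℝ≥0∞, (u / a) ^ t * (v / b) ^ s = u ^ t * v ^ s / (a ^ t * b ^ s) :=
    fun u v => by
      rw [ENNReal.div_rpow_of_nonneg _ _ ht.le, ENNReal.div_rpow_of_nonneg _ _ hs.le,
        ENNReal.mul_div_mul_comm (Or.inr hbs) (Or.inl hat)]
  have hsup : ⨆ x, f x / a = ⨆ x, g x / b := by
    rw [← ENNReal.iSup_div, ← ENNReal.iSup_div, ENNReal.div_self ha₀ hf_top,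
      ENNReal.div_self hb₀ hg_top]
  have hnormalised := rpow_lintegral_mul_rpow_lintegral_le_of_iSup_eq (hf.div_const a)
    (hg.div_const b) (hh.div_const (a ^ t * b ^ s)) hsup ht hs hts fun x y =>
      (hdiv _ _).trans_le (ENNReal.div_le_div_right (H x y) _)
  simp only [div_eq_mul_inv _ a, div_eq_mul_inv _ b, div_eq_mul_inv _ (a ^ t * b ^ s),
    lintegral_mul_const _ hf, lintegral_mul_const _ hg, lintegral_mul_const _ hh] at hnormalised
  simp only [← div_eq_mul_inv, hdiv] at hnormalised
  have hab : a ^ t * b ^ s ≠ 0 := by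
    simp [ENNReal.rpow_eq_zero_iff, ha₀, hb₀, ht.not_gt, hs.not_gt]
  rwa [ENNReal.div_le_iff hab (ENNReal.mul_ne_top hat hbs),
    ENNReal.div_mul_cancel hab (ENNReal.mul_ne_top hat hbs)] at hnormalised

theorem isPrekopaLeindler_volume_real : IsPrekopaLeindler (volume : Measure ℝ) := by
  intro t s ht hs hts f g h hf hg hh H
  rcases eq_or_ne (∫⁻ x, f x) 0 with hf₀ | hf₀
  · simp [hf₀, ENNReal.zero_rpow_of_pos ht]
  rcases eq_or_ne (∫⁻ x, g x) 0 with hg₀ | hg₀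
  · simp [hg₀, ENNReal.zero_rpow_of_pos hs]
  have htrunc : ∀ {u : ℝ → ℝ≥0∞}, Measurable u →
      Tendsto (fun N : ℕ => ∫⁻ x, min (u x) N) atTop (𝓝 (∫⁻ x, u x)) := by
    intro u hu
    refine lintegral_tendsto_of_tendsto_of_monotone (fun N => (by fun_prop)) ?_ ?_
    · exact Eventually.of_forall fun x N M hNM => min_le_min_left _ (by exact_mod_cast hNM)
    · refine Eventually.of_forall fun x => ?_
      have hmin := (tendsto_const_nhds (x := u x) (f := atTop)).min ENNReal.tendsto_nat_nhds_top
      simpa using hmin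
  have hlim := ENNReal.Tendsto.mul
    ((ENNReal.continuous_rpow_const (y := t)).continuousAt.tendsto.comp (htrunc hf))
    (Or.inl (by simp [ENNReal.rpow_eq_zero_iff, hf₀, ht.not_gt]))
    ((ENNReal.continuous_rpow_const (y := s)).continuousAt.tendsto.comp (htrunc hg))
    (Or.inl (by simp [ENNReal.rpow_eq_zero_iff, hg₀, hs.not_gt]))
  have htop : ∀ (u : ℝ → ℝ≥0∞) (N : ℕ), ⨆ x, min (u x) N ≠ ⊤ := fun u N =>
    ((iSup_le fun x => min_le_right (u x) (N : ℝ≥0∞)).trans_lt (ENNReal.natCast_lt_top N)).ne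
  refine le_of_tendsto' hlim fun N => ?_
  refine rpow_lintegral_mul_rpow_lintegral_le_of_iSup_ne_top (hf.min measurable_const)
    (hg.min measurable_const) hh (htop f N) (htop g N) ht hs hts fun x y => le_trans ?_ (H x y)
  gcongr
  · exact min_le_left _ _
  · exact min_le_left _ _

section Prekopa

variable {E F : Type*} [AddCommMonoid E] [Module ℝ E] [MeasurableSpace E]
  [AddCommMonoid F] [Module ℝ F] [MeasurableSpace F]

theorem isPrekopaLeindler_dirac_zero : IsPrekopaLeindler (Measure.dirac (0 : E)) := by
  intro t s _ _ _ f g h hf hg hh H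
  simpa [lintegral_dirac' _ hf, lintegral_dirac' _ hg, lintegral_dirac' _ hh] using H 0 0

theorem IsPrekopaLeindler.smul {μ : Measure E} (hμ : IsPrekopaLeindler μ) (c : ℝ≥0∞) :
    IsPrekopaLeindler (c • μ) := by
  intro t s ht hs hts f g h hf hg hh H
  simp only [lintegral_smul_measure, smul_eq_mul]
  rw [ENNReal.mul_rpow_of_nonneg _ _ ht.le, ENNReal.mul_rpow_of_nonneg _ _ hs.le,
    mul_mul_mul_comm, ← ENNReal.rpow_add_of_nonneg _ _ ht.le hs.le, hts, ENNReal.rpow_one]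
  gcongr
  exact hμ ht hs hts hf hg hh H

theorem IsPrekopaLeindler.map {μ : Measure E} (hμ : IsPrekopaLeindler μ) (L : E →ₗ[ℝ] F)
    (hL : Measurable L) : IsPrekopaLeindler (μ.map L) := by
  intro t s ht hs hts f g h hf hg hh H
  rw [lintegral_map hf hL, lintegral_map hg hL, lintegral_map hh hL]
  refine hμ ht hs hts (hf.comp hL) (hg.comp hL) (hh.comp hL) fun x y => ?_
  simpa only [Function.comp_apply, map_add, map_smul] using H (L x) (L y)

theorem IsPrekopaLeindler.prod {μ : Measure E} {ν : Measure F} [SFinite ν]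
    (hμ : IsPrekopaLeindler μ) (hν : IsPrekopaLeindler ν) : IsPrekopaLeindler (μ.prod ν) := by
  intro t s ht hs hts f g h hf hg hh H
  rw [lintegral_prod _ hf.aemeasurable, lintegral_prod _ hg.aemeasurable,
    lintegral_prod _ hh.aemeasurable]
  refine hμ ht hs hts hf.lintegral_prod_right' hg.lintegral_prod_right' hh.lintegral_prod_right'
    fun x x' => ?_
  exact hν ht hs hts (by fun_prop) (by fun_prop) (by fun_prop) fun y y' => H (x, y) (x', y')

end Prekopa

theorem isPrekopaLeindler_volume_pi (n : ℕ) :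
    IsPrekopaLeindler (volume : Measure (Fin n → ℝ)) := by
  induction n with
  | zero =>
    rw [volume_pi, Measure.pi_of_empty _ 0]
    exact isPrekopaLeindler_dirac_zero
  | succ n ih =>
    have hcons := (volume_preserving_piFinSuccAbove (fun _ : Fin (n + 1) => ℝ) 0).symm
    have hlinear : ⇑(MeasurableEquiv.piFinSuccAbove (fun _ : Fin (n + 1) => ℝ) 0).symm =
        (Fin.consLinearEquiv ℝ fun _ : Fin (n + 1) => ℝ).toLinearMap :=
      funext fun p => Fin.insertNth_zero' p.1 p.2
    rw [hlinear] at hcons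
    rw [← hcons.map_eq]
    exact (isPrekopaLeindler_volume_real.prod ih).map _ hcons.measurable

theorem isPrekopaLeindler_of_isAddHaarMeasure {E : Type*} [NormedAddCommGroup E]
    [NormedSpace ℝ E] [FiniteDimensional ℝ E] [MeasurableSpace E] [BorelSpace E]
    (μ : Measure E) [μ.IsAddHaarMeasure] : IsPrekopaLeindler μ := by
  have := FiniteDimensional.proper_real E
  let e : (Fin (Module.finrank ℝ E) → ℝ) ≃L[ℝ] E := ContinuousLinearEquiv.ofFinrankEq (by simp)
  have hmap : (volume.map e).IsAddHaarMeasure := e.isAddHaarMeasure_map volume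
  rw [Measure.isAddLeftInvariant_eq_smul μ (volume.map e)]
  exact ((isPrekopaLeindler_volume_pi _).map e.toLinearMap e.continuous.measurable).smul _

/-! ### Strong convexity -/

theorem convexOn_line_sub_sq_of_le_hessian {E : Type*} [NormedAddCommGroup E] [NormedSpace ℝ E]
    {V : E → ℝ} (hV : ContDiff ℝ 2 V) {c : ℝ}
    (hHess : ∀ x v, c * ‖v‖ ^ 2 ≤ fderiv ℝ (fderiv ℝ V) x v v) (y v : E) :
    ConvexOn ℝ Set.univ fun r : ℝ => V (y + r • v) - c / 2 * ‖v‖ ^ 2 * r ^ 2 := by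
  have hline : ∀ r : ℝ, HasDerivAt (fun r : ℝ => y + r • v) v r := fun r => by
    simpa using ((hasDerivAt_id r).smul_const v).const_add y
  have hderiv : ∀ r : ℝ, HasDerivAt (fun r : ℝ => V (y + r • v) - c / 2 * ‖v‖ ^ 2 * r ^ 2)
      (fderiv ℝ V (y + r • v) v - c * ‖v‖ ^ 2 * r) r := fun r => by
    have hVline : HasDerivAt (fun r : ℝ => V (y + r • v)) (fderiv ℝ V (y + r • v) v) r :=
      (hV.differentiable two_ne_zero _).hasFDerivAt.comp_hasDerivAt r (hline r)
    refine (hVline.sub ((hasDerivAt_pow 2 r).const_mul (c / 2 * ‖v‖ ^ 2))).congr_deriv ?_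
    push_cast
    ring
  have hderiv2 : ∀ r : ℝ, HasDerivAt (fun r : ℝ => fderiv ℝ V (y + r • v) v - c * ‖v‖ ^ 2 * r)
      (fderiv ℝ (fderiv ℝ V) (y + r • v) v v - c * ‖v‖ ^ 2) r := fun r => by
    have hDVline : HasDerivAt (fun r : ℝ => fderiv ℝ V (y + r • v))
        (fderiv ℝ (fderiv ℝ V) (y + r • v) v) r :=
      ((hV.fderiv_right one_add_one_eq_two.le).differentiable one_ne_zero
        _).hasFDerivAt.comp_hasDerivAt r (hline r)
    refine ((hDVline.clm_apply (hasDerivAt_const r v)).sub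
      ((hasDerivAt_id r).const_mul (c * ‖v‖ ^ 2))).congr_deriv ?_
    simp
  exact convexOn_of_hasDerivWithinAt2_nonneg convex_univ
    (fun r _ => (hderiv r).continuousAt.continuousWithinAt)
    (fun r _ => (hderiv r).hasDerivWithinAt) (fun r _ => (hderiv2 r).hasDerivWithinAt)
    fun r _ => sub_nonneg.2 (hHess _ _)

theorem strongConvexOn_of_le_hessian {E : Type*} [NormedAddCommGroup E] [NormedSpace ℝ E]
    {V : E → ℝ} (hV : ContDiff ℝ 2 V) {c : ℝ}
    (hHess : ∀ x v, c * ‖v‖ ^ 2 ≤ fderiv ℝ (fderiv ℝ V) x v v) :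
    StrongConvexOn Set.univ c V := by
  refine ⟨convex_univ, fun x _ y _ t s ht hs hts => ?_⟩
  have hsegment := (convexOn_line_sub_sq_of_le_hessian hV hHess y (x - y)).2
    (Set.mem_univ 1) (Set.mem_univ 0) ht hs hts
  obtain rfl : s = 1 - t := by linarith
  have hz : y + t • (x - y) = t • x + (1 - t) • y := by module
  simp only [smul_eq_mul, mul_one, mul_zero, add_zero, one_smul, zero_smul, hz, one_pow,
    zero_pow two_ne_zero, sub_zero, add_sub_cancel] at hsegment
  simp only [smul_eq_mul]
  linarith

theorem continuous_of_strongConvexOn {E : Type*} [NormedAddCommGroup E] [NormedSpace ℝ E]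
    [FiniteDimensional ℝ E] {V : E → ℝ} {c : ℝ} (hc : 0 ≤ c)
    (hV : StrongConvexOn Set.univ c V) : Continuous V :=
  continuousOn_univ.1 ((strongConvexOn_zero.1 (StrongConvexOn.mono hc hV)).continuousOn isOpen_univ)

theorem sub_le_of_lipschitzWith_fderiv {E : Type*} [NormedAddCommGroup E] [NormedSpace ℝ E]
    {g : E → ℝ} (hg : Differentiable ℝ g) {M : NNReal} (hM : LipschitzWith M (fderiv ℝ g))
    (x z : E) : g x - g z ≤ ‖fderiv ℝ g z‖ * ‖x - z‖ + M * ‖x - z‖ ^ 2 := by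
  have hremainder : ‖g x - g z - fderiv ℝ g z (x - z)‖ ≤ M * ‖x - z‖ * ‖x - z‖ :=
    (convex_closedBall z ‖x - z‖).norm_image_sub_le_of_norm_fderiv_le' (𝕜 := ℝ)
      (fun y _ => hg y) (fun y hy => (hM.norm_sub_le y z).trans
        (by gcongr; exact mem_closedBall_iff_norm.1 hy))
      (by simp) (mem_closedBall_iff_norm.2 le_rfl)
  have hlinear := (le_abs_self _).trans ((fderiv ℝ g z).le_opNorm (x - z))
  linarith [(le_abs_self _).trans hremainder]

theorem mul_le_sq_div_add {a b K : ℝ} (hK : 0 < K) : a * b ≤ a ^ 2 / (2 * K) + K * b ^ 2 / 2 := by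
  have hsq : a ^ 2 / (2 * K) + K * b ^ 2 / 2 - a * b = (a - K * b) ^ 2 / (2 * K) := by
    field_simp
    ring
  have hnonneg : 0 ≤ (a - K * b) ^ 2 / (2 * K) := by positivity
  linarith

/-- Strong convexity of `V` beats the quadratic error `M ‖x - z‖²` in the expansion of `g` at the
barycentre `z`, and completing the square leaves only `‖Dg z‖²`. -/
theorem sub_le_add_sq_norm_fderiv_div {E : Type*} [NormedAddCommGroup E]
    [NormedSpace ℝ E] {V : E → ℝ} {c : ℝ} (hV : StrongConvexOn Set.univ c V)
    {g : E → ℝ} (hg : Differentiable ℝ g) {M : NNReal} (hM : LipschitzWith M (fderiv ℝ g))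
    {t s K : ℝ} (ht : 0 < t) (hs : 0 < s) (hts : t + s = 1) (hK : 0 < K)
    (hKs : K * s = c * t - 2 * M * s) (x y : E) :
    g x - t * V x - s * V y ≤ g (t • x + s • y) +
      ‖fderiv ℝ g (t • x + s • y)‖ ^ 2 / (2 * K) - V (t • x + s • y) := by
  set z := t • x + s • y with hz
  have hconvex := hV.2 (Set.mem_univ x) (Set.mem_univ y) ht.le hs.le hts
  have htaylor := sub_le_of_lipschitzWith_fderiv hg hM x z
  have hxz : ‖x - z‖ = s * ‖x - y‖ := by
    obtain rfl : t = 1 - s := by linarith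
    rw [show x - z = s • (x - y) by rw [hz]; module, norm_smul, Real.norm_of_nonneg hs.le]
  have hsquare := mul_le_sq_div_add (a := ‖fderiv ℝ g z‖) (b := s * ‖x - y‖) hK
  have hKs' : K * (s * ‖x - y‖) ^ 2 = (c * t - 2 * M * s) * s * ‖x - y‖ ^ 2 := by
    rw [← hKs]
    ring
  rw [hxz] at htaylor
  simp only [smul_eq_mul] at hconvex
  linarith

/-! ### Differentiation of exponential integrals -/

theorem le_of_hasDerivAt_of_eventually_le {F G : ℝ → ℝ} {F' G' a : ℝ} (hF : HasDerivAt F F' a)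
    (hG : HasDerivAt G G' a) (ha : F a = G a) (hle : ∀ᶠ s in 𝓝[>] a, F s ≤ G s) : F' ≤ G' := by
  refine le_of_tendsto_of_tendsto (hF.tendsto_slope.mono_left (nhdsGT_le_nhdsNE a))
    (hG.tendsto_slope.mono_left (nhdsGT_le_nhdsNE a)) ?_
  filter_upwards [hle, self_mem_nhdsWithin] with s hs has
  rw [slope_def_field, slope_def_field, ha]
  exact div_le_div_of_nonneg_right (sub_le_sub_right hs _) (sub_pos.2 has).le

section ExponentialMoments

open ProbabilityTheory

variable {α : Type*} [MeasurableSpace α] {μ : Measure α} [IsFiniteMeasure μ] {X Y : α → ℝ}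

theorem integrable_exp_of_le (hX : AEMeasurable X μ) {B : ℝ} (hB : ∀ x, X x ≤ B) :
    Integrable (fun x => Real.exp (X x)) μ := by
  refine Integrable.of_bound (Real.measurable_exp.comp_aemeasurable hX).aestronglyMeasurable
    (Real.exp B) (ae_of_all _ fun x => ?_)
  rw [Real.norm_of_nonneg (Real.exp_pos _).le]
  exact Real.exp_le_exp.2 (hB x)

theorem integrableExpSet_eq_univ_of_abs_le (hX : AEMeasurable X μ) {B : ℝ}
    (hB : ∀ x, |X x| ≤ B) : integrableExpSet X μ = Set.univ :=
  Set.eq_univ_of_forall fun _ =>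
    integrable_exp_mul_of_mem_Icc hX (ae_of_all _ fun x => abs_le.1 (hB x))

theorem hasDerivAt_cgf_of_abs_le (hX : AEMeasurable X μ) {B : ℝ} (hB : ∀ x, |X x| ≤ B) (t : ℝ) :
    HasDerivAt (cgf X μ) ((∫ x, X x * Real.exp (t * X x) ∂μ) / mgf X μ t) t := by
  have ht : t ∈ interior (integrableExpSet X μ) := by
    rw [integrableExpSet_eq_univ_of_abs_le hX hB, interior_univ]
    exact Set.mem_univ t
  exact deriv_cgf ht ▸ (analyticAt_cgf ht).differentiableAt.hasDerivAt

theorem hasDerivAt_one_sub_mul_cgf_inv (hX : AEMeasurable X μ) {B : ℝ} (hB : ∀ x, |X x| ≤ B) :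
    HasDerivAt (fun s : ℝ => (1 - s) * cgf X μ (1 - s)⁻¹)
      ((∫ x, X x * Real.exp (X x) ∂μ) / mgf X μ 1 - cgf X μ 1) 0 := by
  have hcgf := hasDerivAt_cgf_of_abs_le hX hB (1 - 0)⁻¹
  have hsub : HasDerivAt (fun s : ℝ => 1 - s) (-1) 0 := (hasDerivAt_id 0).const_sub 1
  refine (hsub.mul (hcgf.comp 0 (hsub.inv (by simp)))).congr_deriv ?_
  simp only [Function.comp_apply, Pi.inv_apply, sub_zero, inv_one, one_mul, neg_neg, one_pow,
    div_one, mul_one, neg_mul]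
  ring

theorem integral_tilted_eq_integral_mul_exp_div {α : Type*} [MeasurableSpace α] (μ : Measure α)
    (X Y : α → ℝ) :
    ∫ x, Y x ∂(μ.tilted X) = (∫ x, Y x * Real.exp (X x) ∂μ) / ∫ x, Real.exp (X x) ∂μ := by
  rw [integral_tilted, ← integral_div]
  exact integral_congr_ae (ae_of_all _ fun x => by simp only [smul_eq_mul]; ring)

/-- Both sides of `hle` agree at `s = 0`; the conclusion compares their logarithmic derivatives
there. -/
theorem integral_mul_exp_sub_le_of_rpow_mgf_le [NeZero μ] (hX : AEMeasurable X μ)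
    (hY : AEMeasurable Y μ) {B C : ℝ} (hB : ∀ x, |X x| ≤ B) (hC : ∀ x, |Y x| ≤ C) {θ : ℝ → ℝ}
    {θ' : ℝ} (hθ : HasDerivAt θ θ' 0) (hθ₀ : θ 0 = 0)
    (hle : ∀ᶠ s in 𝓝[>] 0,
      mgf X μ (1 - s)⁻¹ ^ (1 - s) ≤ ∫ x, Real.exp (X x + θ s * Y x) ∂μ) :
    ∫ x, X x * Real.exp (X x) ∂μ - (∫ x, Real.exp (X x) ∂μ) * Real.log (∫ x, Real.exp (X x) ∂μ) ≤
      θ' * ∫ x, Y x * Real.exp (X x) ∂μ := by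
  have hexpX : Integrable (fun x => Real.exp (X x)) μ :=
    integrable_exp_of_le hX fun x => (le_abs_self _).trans (hB x)
  have hprob := isProbabilityMeasure_tilted hexpX
  set Z := ∫ x, Real.exp (X x) ∂μ with hZ
  have hZpos : 0 < Z := integral_exp_pos hexpX
  have hmgf : mgf X μ 1 = Z := by simp [mgf, hZ]
  have hlhs := hasDerivAt_one_sub_mul_cgf_inv hX hB
  have hrhs : HasDerivAt (fun s : ℝ => Real.log Z + cgf Y (μ.tilted X) (θ s))
      (θ' * (∫ x, Y x * Real.exp (X x) ∂μ) / Z) 0 := by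
    have hY' := hY.mono_ac (tilted_absolutelyContinuous μ X)
    refine (((hasDerivAt_cgf_of_abs_le hY' hC (θ 0)).comp 0 hθ).const_add _).congr_deriv ?_
    simp only [hθ₀, zero_mul, Real.exp_zero, mul_one, mgf_zero, div_one,
      integral_tilted_eq_integral_mul_exp_div, ← hZ]
    ring
  have hderiv := le_of_hasDerivAt_of_eventually_le hlhs hrhs (by simp [cgf, hmgf, hθ₀]) ?_
  · rw [cgf, hmgf, div_sub' hZpos.ne', div_le_div_iff_of_pos_right hZpos] at hderiv
    exact hderiv
  filter_upwards [hle] with s hs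
  have hmgf_pos : 0 < mgf X μ (1 - s)⁻¹ :=
    mgf_pos' (NeZero.ne μ)
      (integrable_exp_mul_of_mem_Icc hX (ae_of_all _ fun x => abs_le.1 (hB x)))
  have htilted : mgf Y (μ.tilted X) (θ s) = (∫ x, Real.exp (X x + θ s * Y x) ∂μ) / Z :=
    integral_exp_tilted X fun x => θ s * Y x
  have hlog := Real.log_le_log (by positivity) hs
  rw [Real.log_rpow hmgf_pos] at hlog
  rwa [cgf, cgf, htilted, Real.log_div ((Real.rpow_pos_of_pos hmgf_pos _).trans_le hs).ne'
    hZpos.ne', add_sub_cancel]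

end ExponentialMoments

/-! ### The Gibbs measure of a strongly convex potential -/

section GibbsMeasure

open ProbabilityTheory

variable {n : ℕ} {V : EuclideanSpace ℝ (Fin n) → ℝ}

theorem lintegral_exp_gibbsMeasure (hV : Continuous V) {u : EuclideanSpace ℝ (Fin n) → ℝ}
    (hu : Continuous u) :
    ∫⁻ x, ENNReal.ofReal (Real.exp (u x)) ∂(gibbsMeasure V) =
      ∫⁻ x, ENNReal.ofReal (Real.exp (u x - V x)) := by
  rw [gibbsMeasure, lintegral_withDensity_eq_lintegral_mul _ (by fun_prop) (by fun_prop)]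
  refine lintegral_congr fun x => ?_
  rw [Pi.mul_apply, ← ENNReal.ofReal_mul (Real.exp_pos _).le, ← Real.exp_add, neg_add_eq_sub]

theorem rpow_integral_exp_gibbsMeasure_le [IsProbabilityMeasure (gibbsMeasure V)]
    (hV : Continuous V) {u w : EuclideanSpace ℝ (Fin n) → ℝ} (hu : Continuous u)
    (hw : Continuous w) (hu_int : Integrable (fun x => Real.exp (u x)) (gibbsMeasure V))
    (hw_int : Integrable (fun x => Real.exp (w x)) (gibbsMeasure V)) {t s : ℝ} (ht : 0 < t)
    (hs : 0 < s) (hts : t + s = 1)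
    (H : ∀ x y, t * u x - t * V x - s * V y ≤ w (t • x + s • y) - V (t • x + s • y)) :
    (∫ x, Real.exp (u x) ∂(gibbsMeasure V)) ^ t ≤ ∫ x, Real.exp (w x) ∂(gibbsMeasure V) := by
  have hPL := isPrekopaLeindler_of_isAddHaarMeasure volume ht hs hts
    (f := fun x => ENNReal.ofReal (Real.exp (u x - V x)))
    (g := fun x => ENNReal.ofReal (Real.exp (0 - V x)))
    (h := fun x => ENNReal.ofReal (Real.exp (w x - V x)))
    (by fun_prop) (by fun_prop) (by fun_prop) fun x y => by
      rw [ENNReal.ofReal_rpow_of_pos (Real.exp_pos _), ENNReal.ofReal_rpow_of_pos (Real.exp_pos _),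
        ← Real.exp_mul, ← Real.exp_mul, ← ENNReal.ofReal_mul (Real.exp_pos _).le, ← Real.exp_add]
      exact ENNReal.ofReal_le_ofReal (Real.exp_le_exp.2 (by linarith [H x y]))
  have hnonneg : ∀ v : EuclideanSpace ℝ (Fin n) → ℝ, 0 ≤ fun x => Real.exp (v x) :=
    fun v x => (Real.exp_pos (v x)).le
  rw [← lintegral_exp_gibbsMeasure hV hu, ← lintegral_exp_gibbsMeasure hV continuous_const,
    ← lintegral_exp_gibbsMeasure hV hw,
    ← ofReal_integral_eq_lintegral_ofReal hu_int (ae_of_all _ (hnonneg u)),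
    ← ofReal_integral_eq_lintegral_ofReal hw_int (ae_of_all _ (hnonneg w)),
    ENNReal.ofReal_rpow_of_nonneg (integral_nonneg (hnonneg u)) ht.le] at hPL
  simp only [Real.exp_zero, ENNReal.ofReal_one, lintegral_one, measure_univ, ENNReal.one_rpow,
    mul_one] at hPL
  exact (ENNReal.ofReal_le_ofReal_iff (integral_nonneg (hnonneg w))).1 hPL

variable {c : ℝ}

theorem rpow_mgf_gibbsMeasure_le [IsProbabilityMeasure (gibbsMeasure V)] (hc : 0 < c)
    (hV : StrongConvexOn Set.univ c V) {g : EuclideanSpace ℝ (Fin n) → ℝ}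
    (hg : Differentiable ℝ g) {B L : ℝ} (hB : ∀ x, |g x| ≤ B) (hL : ∀ x, ‖fderiv ℝ g x‖ ≤ L)
    {M : NNReal} (hM : LipschitzWith M (fderiv ℝ g)) {s : ℝ} (hs : 0 < s) (hs1 : s < 1)
    (hsM : 0 < c * (1 - s) - 2 * M * s) :
    mgf g (gibbsMeasure V) (1 - s)⁻¹ ^ (1 - s) ≤
      ∫ x, Real.exp (g x + s / (2 * (c * (1 - s) - 2 * M * s)) * ‖fderiv ℝ g x‖ ^ 2)
        ∂(gibbsMeasure V) := by
  have ht : 0 < 1 - s := sub_pos.2 hs1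
  have hgcont : Continuous g := hg.continuous
  have hDcont : Continuous (fderiv ℝ g) := hM.continuous
  set q := c * (1 - s) - 2 * M * s
  have hu_int : Integrable (fun x => Real.exp ((1 - s)⁻¹ * g x)) (gibbsMeasure V) :=
    integrable_exp_of_le (by fun_prop) (B := (1 - s)⁻¹ * B) fun x => by
      gcongr
      exact (le_abs_self _).trans (hB x)
  have hw_int : Integrable (fun x => Real.exp (g x + s / (2 * q) * ‖fderiv ℝ g x‖ ^ 2))
      (gibbsMeasure V) :=
    integrable_exp_of_le (by fun_prop) (B := B + s / (2 * q) * L ^ 2) fun x => by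
      gcongr
      · exact (le_abs_self _).trans (hB x)
      · exact hL x
  refine rpow_integral_exp_gibbsMeasure_le (continuous_of_strongConvexOn hc.le hV) (by fun_prop)
    (by fun_prop) hu_int hw_int ht hs (sub_add_cancel 1 s) fun x y => ?_
  have hpointwise := sub_le_add_sq_norm_fderiv_div hV hg hM ht hs (sub_add_cancel 1 s)
    (K := q / s) (by positivity) (div_mul_cancel₀ q hs.ne') x y
  rw [mul_inv_cancel_left₀ ht.ne', show s / (2 * q) = (2 * (q / s))⁻¹ by field_simp,
    inv_mul_eq_div]
  exact hpointwise

theorem entropy_exp_le [IsProbabilityMeasure (gibbsMeasure V)] (hc : 0 < c)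
    (hV : StrongConvexOn Set.univ c V) {g : EuclideanSpace ℝ (Fin n) → ℝ}
    (hg : Differentiable ℝ g) {B L : ℝ} (hB : ∀ x, |g x| ≤ B) (hL : ∀ x, ‖fderiv ℝ g x‖ ≤ L)
    {M : NNReal} (hM : LipschitzWith M (fderiv ℝ g)) :
    entropy (gibbsMeasure V) (fun x => Real.exp (g x)) ≤
      1 / (2 * c) * ∫ x, ‖fderiv ℝ g x‖ ^ 2 * Real.exp (g x) ∂(gibbsMeasure V) := by
  have hgcont : Continuous g := hg.continuous
  have hq : HasDerivAt (fun s : ℝ => 2 * (c * (1 - s) - 2 * M * s)) (2 * (-c - 2 * M)) 0 := by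
    simpa using ((((hasDerivAt_id (0 : ℝ)).const_sub 1).const_mul c).sub
      ((hasDerivAt_id 0).const_mul (2 * (M : ℝ)))).const_mul 2
  have hθ : HasDerivAt (fun s : ℝ => s / (2 * (c * (1 - s) - 2 * M * s))) (1 / (2 * c)) 0 := by
    refine ((hasDerivAt_id (0 : ℝ)).div hq (by simp [hc.ne'])).congr_deriv ?_
    simp only [id_eq, sub_zero, mul_one, mul_zero, zero_mul, one_mul]
    field_simp
  have hqpos : ∀ᶠ s : ℝ in 𝓝[>] 0, 0 < c * (1 - s) - 2 * M * s := by
    have hcont : ContinuousAt (fun s : ℝ => c * (1 - s) - 2 * M * s) 0 := by fun_prop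
    exact (hcont.eventually (lt_mem_nhds (by simpa using hc))).filter_mono nhdsWithin_le_nhds
  have hsq : ∀ x, |‖fderiv ℝ g x‖ ^ 2| ≤ L ^ 2 := fun x => by
    rw [abs_of_nonneg (sq_nonneg _)]
    gcongr
    exact hL x
  simp only [entropy, Real.log_exp, mul_comm (Real.exp _)]
  refine integral_mul_exp_sub_le_of_rpow_mgf_le (by fun_prop) (by fun_prop) hB hsq hθ (by simp) ?_
  filter_upwards [hqpos, self_mem_nhdsWithin, nhdsWithin_le_nhds (gt_mem_nhds one_pos)]
    with s hsM hs hs1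
  exact rpow_mgf_gibbsMeasure_le hc hV hg hB hL hM hs hs1 hsM

end GibbsMeasure

/-! ### The logarithmic Sobolev inequality -/

section Regularization

variable {E : Type*} [NormedAddCommGroup E] [NormedSpace ℝ E] {φ : E → ℝ} {ε : ℝ}

theorem hasFDerivAt_log_sq_add {φ' : E →L[ℝ] ℝ} {x : E} (hφ : HasFDerivAt φ φ' x) (hε : 0 < ε) :
    HasFDerivAt (fun y => Real.log (φ y ^ 2 + ε)) ((φ x ^ 2 + ε)⁻¹ • (2 * φ x) • φ') x := by
  simpa using ((hφ.pow 2).add_const ε).log (by positivity)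

theorem sq_norm_fderiv_log_sq_add_mul_le {x : E} (hφ : DifferentiableAt ℝ φ x) (hε : 0 < ε) :
    ‖fderiv ℝ (fun y => Real.log (φ y ^ 2 + ε)) x‖ ^ 2 * (φ x ^ 2 + ε) ≤
      4 * ‖fderiv ℝ φ x‖ ^ 2 := by
  have hpos : 0 < φ x ^ 2 + ε := by positivity
  rw [(hasFDerivAt_log_sq_add hφ.hasFDerivAt hε).fderiv, norm_smul, norm_smul, norm_inv,
    Real.norm_of_nonneg hpos.le, Real.norm_eq_abs]
  calc ((φ x ^ 2 + ε)⁻¹ * (|2 * φ x| * ‖fderiv ℝ φ x‖)) ^ 2 * (φ x ^ 2 + ε)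
      = φ x ^ 2 / (φ x ^ 2 + ε) * (4 * ‖fderiv ℝ φ x‖ ^ 2) := by
        rw [mul_pow, mul_pow, sq_abs]
        field_simp
        ring
    _ ≤ 4 * ‖fderiv ℝ φ x‖ ^ 2 :=
        mul_le_of_le_one_left (by positivity) ((div_le_one hpos).2 (by linarith))

end Regularization

theorem hasCompactSupport_log_sq_add_sub {X : Type*} [TopologicalSpace X] {φ : X → ℝ}
    (hφ : HasCompactSupport φ) (ε : ℝ) :
    HasCompactSupport fun x => Real.log (φ x ^ 2 + ε) - Real.log ε :=
  hφ.comp_left (g := fun y => Real.log (y ^ 2 + ε) - Real.log ε) (by simp)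

section Gradient

variable {E : Type*} [NormedAddCommGroup E] [InnerProductSpace ℝ E] [CompleteSpace E] {φ : E → ℝ}

theorem norm_gradient_eq_norm_fderiv (φ : E → ℝ) (x : E) : ‖gradient φ x‖ = ‖fderiv ℝ φ x‖ :=
  LinearIsometryEquiv.norm_map _ _

theorem continuous_gradient (hφ : ContDiff ℝ 1 φ) : Continuous (gradient φ) :=
  (LinearIsometryEquiv.continuous _).comp (hφ.continuous_fderiv one_ne_zero)

theorem hasCompactSupport_gradient (hφ : HasCompactSupport φ) : HasCompactSupport (gradient φ) :=
  (hφ.fderiv ℝ).comp_left (map_zero (InnerProductSpace.toDual ℝ E).symm)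

end Gradient

section CompactSupport

variable {n : ℕ} {V : EuclideanSpace ℝ (Fin n) → ℝ} {c : ℝ}

theorem entropy_exp_le_of_hasCompactSupport_sub_const [IsProbabilityMeasure (gibbsMeasure V)]
    (hc : 0 < c) (hV : StrongConvexOn Set.univ c V) {g : EuclideanSpace ℝ (Fin n) → ℝ}
    (hg : ContDiff ℝ 2 g) {a : ℝ} (hga : HasCompactSupport fun x => g x - a) :
    entropy (gibbsMeasure V) (fun x => Real.exp (g x)) ≤
      1 / (2 * c) * ∫ x, ‖fderiv ℝ g x‖ ^ 2 * Real.exp (g x) ∂(gibbsMeasure V) := by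
  have hDg : ContDiff ℝ 1 (fderiv ℝ g) := hg.fderiv_right (by norm_num)
  have hDg_supp : HasCompactSupport (fderiv ℝ g) := by
    have hfderiv : fderiv ℝ (fun x => g x - a) = fderiv ℝ g := funext fun _ => fderiv_sub_const a
    exact hfderiv ▸ hga.fderiv ℝ
  obtain ⟨B, hB⟩ := hga.exists_bound_of_continuous (hg.continuous.sub continuous_const)
  obtain ⟨L, hL⟩ := hDg_supp.exists_bound_of_continuous hDg.continuous
  obtain ⟨M, hM⟩ := ContDiff.lipschitzWith_of_hasCompactSupport hDg_supp hDg one_ne_zero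
  have hgB : ∀ x, |g x| ≤ B + |a| := fun x => by
    simpa using (abs_add_le (g x - a) a).trans (add_le_add_left (hB x) _)
  exact entropy_exp_le hc hV (hg.differentiable two_ne_zero) hgB hL hM

theorem entropy_sq_add_le [IsProbabilityMeasure (gibbsMeasure V)] (hc : 0 < c)
    (hV : StrongConvexOn Set.univ c V) {φ : EuclideanSpace ℝ (Fin n) → ℝ} (hφ : ContDiff ℝ 2 φ)
    (hφc : HasCompactSupport φ) {ε : ℝ} (hε : 0 < ε) :
    entropy (gibbsMeasure V) (fun x => φ x ^ 2 + ε) ≤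
      2 / c * ∫ x, ‖gradient φ x‖ ^ 2 ∂(gibbsMeasure V) := by
  have hpos : ∀ x, 0 < φ x ^ 2 + ε := fun x => by positivity
  have hg : ContDiff ℝ 2 fun x => Real.log (φ x ^ 2 + ε) :=
    ((hφ.pow 2).add contDiff_const).log fun x => (hpos x).ne'
  have hgrad : Integrable (fun x => ‖gradient φ x‖ ^ 2) (gibbsMeasure V) :=
    ((continuous_gradient (hφ.of_le one_le_two)).memLp_of_hasCompactSupport
      (hasCompactSupport_gradient hφc)).integrable_norm_pow two_ne_zero
  have hexp := entropy_exp_le_of_hasCompactSupport_sub_const hc hV hg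
    (hasCompactSupport_log_sq_add_sub hφc ε)
  simp only [Real.exp_log (hpos _)] at hexp
  calc entropy (gibbsMeasure V) (fun x => φ x ^ 2 + ε)
      ≤ 1 / (2 * c) * ∫ x, ‖fderiv ℝ (fun y => Real.log (φ y ^ 2 + ε)) x‖ ^ 2 * (φ x ^ 2 + ε)
          ∂(gibbsMeasure V) := hexp
    _ ≤ 1 / (2 * c) * ∫ x, 4 * ‖gradient φ x‖ ^ 2 ∂(gibbsMeasure V) := by
        gcongr 1 / (2 * c) * ?_
        refine integral_mono_of_nonneg
          (ae_of_all _ fun x => mul_nonneg (sq_nonneg _) (hpos x).le) (hgrad.const_mul 4)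
          (ae_of_all _ fun x => ?_)
        simpa only [norm_gradient_eq_norm_fderiv] using
          sq_norm_fderiv_log_sq_add_mul_le (hφ.differentiable two_ne_zero x) hε
    _ = 2 / c * ∫ x, ‖gradient φ x‖ ^ 2 ∂(gibbsMeasure V) := by
        rw [integral_const_mul]
        ring

end CompactSupport

theorem integrable_comp_of_hasCompactSupport {X : Type*} [TopologicalSpace X] [MeasurableSpace X]
    [OpensMeasurableSpace X] {μ : Measure X} [IsFiniteMeasure μ] {φ : X → ℝ} (hφ : Continuous φ)
    (hφc : HasCompactSupport φ) {F : ℝ → ℝ} (hF : Continuous F) :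
    Integrable (fun x => F (φ x)) μ := by
  have hcomp : Integrable (fun x => F (φ x) - F 0) μ :=
    ((hF.comp hφ).sub continuous_const).integrable_of_hasCompactSupport
      (hφc.comp_left (g := fun y => F y - F 0) (sub_self _))
  exact (hcomp.add (integrable_const (F 0))).congr (ae_of_all _ fun x => sub_add_cancel _ _)

section LowerSemicontinuity

variable {α : Type*} [MeasurableSpace α] {μ : Measure α}

theorem integrable_and_integral_le_of_tendsto_of_nonneg {F : ℕ → α → ℝ} {f : α → ℝ}
    (hF : ∀ k, Integrable (F k) μ) (hnonneg : ∀ k x, 0 ≤ F k x)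
    (hlim : ∀ᵐ x ∂μ, Tendsto (fun k => F k x) atTop (𝓝 (f x))) {b : ℕ → ℝ} {b₀ : ℝ}
    (hb : Tendsto b atTop (𝓝 b₀)) (hle : ∀ k, ∫ x, F k x ∂μ ≤ b k) :
    Integrable f μ ∧ ∫ x, f x ∂μ ≤ b₀ := by
  have hf_nonneg : 0 ≤ᵐ[μ] f := by
    filter_upwards [hlim] with x hx using ge_of_tendsto' hx fun k => hnonneg k x
  have hf_meas : AEStronglyMeasurable f μ :=
    aestronglyMeasurable_of_tendsto_ae atTop (fun k => (hF k).1) hlim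
  have hfatou : ∫⁻ x, ENNReal.ofReal (f x) ∂μ ≤ ENNReal.ofReal b₀ := by
    calc ∫⁻ x, ENNReal.ofReal (f x) ∂μ
        = ∫⁻ x, liminf (fun k => ENNReal.ofReal (F k x)) atTop ∂μ := by
          refine lintegral_congr_ae ?_
          filter_upwards [hlim] with x hx using (ENNReal.tendsto_ofReal hx).liminf_eq.symm
      _ ≤ liminf (fun k => ∫⁻ x, ENNReal.ofReal (F k x) ∂μ) atTop :=
          lintegral_liminf_le' fun k => (hF k).1.aemeasurable.ennreal_ofReal
      _ ≤ liminf (fun k => ENNReal.ofReal (b k)) atTop := by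
          refine liminf_le_liminf (Eventually.of_forall fun k => ?_)
          rw [← ofReal_integral_eq_lintegral_ofReal (hF k) (ae_of_all _ (hnonneg k))]
          exact ENNReal.ofReal_le_ofReal (hle k)
      _ = ENNReal.ofReal b₀ := (ENNReal.tendsto_ofReal hb).liminf_eq
  have hf : Integrable f μ :=
    ⟨hf_meas, (hasFiniteIntegral_iff_ofReal hf_nonneg).2 (hfatou.trans_lt ENNReal.ofReal_lt_top)⟩
  have hb_nonneg : 0 ≤ b₀ :=
    ge_of_tendsto' hb fun k => (integral_nonneg (hnonneg k)).trans (hle k)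
  rw [← ofReal_integral_eq_lintegral_ofReal hf hf_nonneg,
    ENNReal.ofReal_le_ofReal_iff hb_nonneg] at hfatou
  exact ⟨hf, hfatou⟩

theorem integrable_and_integral_le_of_tendsto_of_le [IsFiniteMeasure μ] {F : ℕ → α → ℝ} {f : α → ℝ}
    {C : ℝ} (hF : ∀ k, Integrable (F k) μ) (hC : ∀ k x, C ≤ F k x)
    (hlim : ∀ᵐ x ∂μ, Tendsto (fun k => F k x) atTop (𝓝 (f x))) {b : ℕ → ℝ} {b₀ : ℝ}
    (hb : Tendsto b atTop (𝓝 b₀)) (hle : ∀ k, ∫ x, F k x ∂μ ≤ b k) :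
    Integrable f μ ∧ ∫ x, f x ∂μ ≤ b₀ := by
  obtain ⟨hfC, hfC_le⟩ := integrable_and_integral_le_of_tendsto_of_nonneg
    (F := fun k x => F k x - C) (f := fun x => f x - C) (fun k => (hF k).sub (integrable_const C))
    (fun k x => sub_nonneg.2 (hC k x)) (hlim.mono fun x hx => hx.sub_const C)
    (hb.sub_const (∫ _, C ∂μ)) fun k => by
      rw [integral_sub (hF k) (integrable_const C)]
      exact sub_le_sub_right (hle k) _
  have hf : Integrable f μ :=
    (hfC.add (integrable_const C)).congr (ae_of_all _ fun x => sub_add_cancel (f x) C)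
  rw [integral_sub hf (integrable_const C)] at hfC_le
  exact ⟨hf, sub_le_sub_iff_right _ |>.1 hfC_le⟩

theorem integral_norm_sq_eq_norm_toLp_sq {F : Type*} [NormedAddCommGroup F] {u : α → F}
    (hu : MemLp u 2 μ) : ∫ x, ‖u x‖ ^ 2 ∂μ = ‖hu.toLp‖ ^ 2 := by
  have hnonneg : 0 ≤ ∫ x, ‖u x‖ ^ 2 ∂μ := integral_nonneg fun x => sq_nonneg _
  rw [Lp.norm_toLp, hu.eLpNorm_eq_integral_rpow_norm two_ne_zero ENNReal.ofNat_ne_top,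
    ENNReal.toReal_ofReal (by positivity)]
  simp only [ENNReal.toReal_ofNat, Real.rpow_ofNat]
  rw [← Real.rpow_natCast, ← Real.rpow_mul hnonneg]
  simp

theorem tendsto_integral_norm_sq_of_eLpNorm {F : Type*} [NormedAddCommGroup F] {u : ℕ → α → F}
    {w : α → F} (hu : ∀ k, MemLp (u k) 2 μ) (hw : MemLp w 2 μ)
    (h : Tendsto (fun k => eLpNorm (fun x => u k x - w x) 2 μ) atTop (𝓝 0)) :
    Tendsto (fun k => ∫ x, ‖u k x‖ ^ 2 ∂μ) atTop (𝓝 (∫ x, ‖w x‖ ^ 2 ∂μ)) := by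
  simpa only [integral_norm_sq_eq_norm_toLp_sq hw, fun k => integral_norm_sq_eq_norm_toLp_sq (hu k)]
    using (((Lp.tendsto_Lp_iff_tendsto_eLpNorm'' u hu w hw).2 h).norm).pow 2

end LowerSemicontinuity

section DirichletForm

variable {n : ℕ}

theorem neg_one_le_mul_log {y : ℝ} (hy : 0 ≤ y) : -1 ≤ y * Real.log y := by
  linarith [Real.self_sub_one_le_mul_log hy]

theorem integrable_and_entropy_le_of_tendsto {μ : Measure (EuclideanSpace ℝ (Fin n))}
    [IsFiniteMeasure μ] {h : ℕ → EuclideanSpace ℝ (Fin n) → ℝ} {h₀ : EuclideanSpace ℝ (Fin n) → ℝ}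
    (hnonneg : ∀ k x, 0 ≤ h k x)
    (hlog : ∀ k, Integrable (fun x => h k x * Real.log (h k x)) μ)
    (hlim : ∀ᵐ x ∂μ, Tendsto (fun k => h k x) atTop (𝓝 (h₀ x)))
    (hint : Tendsto (fun k => ∫ x, h k x ∂μ) atTop (𝓝 (∫ x, h₀ x ∂μ))) {b : ℕ → ℝ} {b₀ : ℝ}
    (hb : Tendsto b atTop (𝓝 b₀)) (hle : ∀ k, entropy μ (h k) ≤ b k) :
    Integrable (fun x => h₀ x * Real.log (h₀ x)) μ ∧ entropy μ h₀ ≤ b₀ := by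
  have hlimit := integrable_and_integral_le_of_tendsto_of_le hlog
    (fun k x => neg_one_le_mul_log (hnonneg k x))
    (hlim.mono fun x hx => (Real.continuous_mul_log.tendsto (h₀ x)).comp hx)
    (hb.add ((Real.continuous_mul_log.tendsto (∫ x, h₀ x ∂μ)).comp hint))
    fun k => sub_le_iff_le_add.1 (hle k)
  exact ⟨hlimit.1, sub_le_iff_le_add.2 hlimit.2⟩

theorem isDirichletGradient_dirichletGradient {μ : Measure (EuclideanSpace ℝ (Fin n))}
    {f : EuclideanSpace ℝ (Fin n) → ℝ} (hf : f ∈ dirichletDomain μ) :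
    IsDirichletGradient μ f (dirichletGradient μ f) := by
  have hf' : ∃ G, IsDirichletGradient μ f G := hf
  rw [dirichletGradient, dif_pos hf']
  exact hf'.choose_spec

variable {V : EuclideanSpace ℝ (Fin n) → ℝ} {c : ℝ}

theorem integrable_and_entropy_sq_le_of_isDirichletGradient [IsProbabilityMeasure (gibbsMeasure V)]
    (hc : 0 < c) (hV : StrongConvexOn Set.univ c V) {f : EuclideanSpace ℝ (Fin n) → ℝ}
    {G : EuclideanSpace ℝ (Fin n) → EuclideanSpace ℝ (Fin n)}
    (hfG : IsDirichletGradient (gibbsMeasure V) f G) :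
    Integrable (fun x => f x ^ 2 * Real.log (f x ^ 2)) (gibbsMeasure V) ∧
      entropy (gibbsMeasure V) (fun x => f x ^ 2) ≤
        2 / c * ∫ x, ‖G x‖ ^ 2 ∂(gibbsMeasure V) := by
  obtain ⟨hf, hG, φ, hφ, hφc, hφf, hφG⟩ := hfG
  have hφm : ∀ k, MemLp (φ k) 2 (gibbsMeasure V) := fun k =>
    (hφ k).continuous.memLp_of_hasCompactSupport (hφc k)
  have hgradm : ∀ k, MemLp (gradient (φ k)) 2 (gibbsMeasure V) := fun k =>
    (continuous_gradient ((hφ k).of_le (by norm_cast))).memLp_of_hasCompactSupport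
      (hasCompactSupport_gradient (hφc k))
  obtain ⟨ns, hns, hae⟩ := (tendstoInMeasure_of_tendsto_eLpNorm two_ne_zero
    (fun k => (hφm k).1) hf.1 hφf).exists_seq_tendsto_ae
  have hε := tendsto_one_div_add_atTop_nhds_zero_nat (𝕜 := ℝ)
  have hmass := (tendsto_integral_norm_sq_of_eLpNorm hφm hf hφf).comp hns.tendsto_atTop
  have henergy := (tendsto_integral_norm_sq_of_eLpNorm hgradm hG hφG).comp hns.tendsto_atTop
  simp only [Real.norm_eq_abs, sq_abs] at hmass
  -- A single limit removes both the regularization `1 / (k + 1)` and the smoothness of `φ`.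
  refine integrable_and_entropy_le_of_tendsto
    (h := fun k x => φ (ns k) x ^ 2 + 1 / ((k : ℝ) + 1)) (fun k x => by positivity)
    (fun k => ?_) ?_ ?_ (henergy.const_mul (2 / c))
    fun k => entropy_sq_add_le hc hV ((hφ (ns k)).of_le (by norm_cast)) (hφc (ns k)) (by positivity)
  · exact integrable_comp_of_hasCompactSupport (hφ (ns k)).continuous (hφc (ns k))
      (F := fun y => (y ^ 2 + 1 / ((k : ℝ) + 1)) * Real.log (y ^ 2 + 1 / ((k : ℝ) + 1)))
      (Real.continuous_mul_log.comp (by fun_prop))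
  · filter_upwards [hae] with x hx
    simpa using (hx.pow 2).add hε
  · have hint : ∀ k : ℕ, ∫ x, (φ (ns k) x ^ 2 + 1 / ((k : ℝ) + 1)) ∂(gibbsMeasure V) =
        ∫ x, φ (ns k) x ^ 2 ∂(gibbsMeasure V) + 1 / ((k : ℝ) + 1) := fun k => by
      simp [integral_add (hφm (ns k)).integrable_sq (integrable_const _)]
    simpa only [hint, add_zero, Function.comp_apply] using hmass.add hε

theorem proposition1p1_general [IsProbabilityMeasure (gibbsMeasure V)] (hc : 0 < c)
    (hV : StrongConvexOn Set.univ c V) : LogSobolev (gibbsMeasure V) (2 / c) := by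
  intro f hf
  simpa only [dirichletForm, real_inner_self_eq_norm_sq] using
    integrable_and_entropy_sq_le_of_isDirichletGradient hc hV
      (isDirichletGradient_dirichletGradient hf)

end DirichletForm

theorem proposition1p1 {n : ℕ} (V : EuclideanSpace ℝ (Fin n) → ℝ) (hV : ContDiff ℝ 2 V)
    (hμ : IsProbabilityMeasure (gibbsMeasure V)) (c : ℝ) (hc : 0 < c)
    (hHess : ∀ x v : EuclideanSpace ℝ (Fin n),
      c * ‖v‖ ^ 2 ≤ fderiv ℝ (fderiv ℝ V) x v v) :
    LogSobolev (gibbsMeasure V) (2 / c) :=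
  proposition1p1_general hc (strongConvexOn_of_le_hessian hV hHess)
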